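/- **Setting.** Processes $p_1,\dots,p_n$ with initial values $v_1,\dots,v_n\in\mathbb R$ are the nodes of a communication graph $G$. A trusted third party (the key holder), which has no initial value, owns the secret key of a homomorphic encryption scheme; all agents have the public key. The scheme is idealized: ciphertexts are formal results of the operations encryption (with fresh private random coins), addition and multiplication of two ciphertexts, addition and multiplication of a ciphertext and a plaintext vector, and cyclic rotation. These operations act slotwise on real vectors with $m=2^{\lceil\log_2 n\rceil}$ slots ($m=n$ if $n$ is a power of two; further slots are padded with $0$), and a ciphertext can be decrypted only with the secret key. Channels are asynchronous and confidential: a message is seen by its sender and its receiver only, and messages in transit are delivered in any order after any delay. **Algorithm 1.** Process $p_i$ sets $Votes:=Enc(0,\dots,v_i,\dots,0)$ and $Counts:=(0,\dots,1,\dots,0)$ (nonzero in position $i$) and sends $(Votes,Counts)$ to its neighbors, $Counts$ being in plaintext. When it receives a message $(V,K)$, it ignores it if $Counts$ is already nonzero wherever $K$ is. Otherwise it replaces $Votes$ by $add(Votes,V)$ and $Counts$ by $Counts+K$ and sends the new pair to its neighbors; if then no entry of $Counts$ is $0$, it decides the ciphertext $Prepare(Votes,Counts)$ and sends it to the key holder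 and to its neighbors. $Prepare$ multiplies $Votes$ slotwise by $\left(\frac1{n\,Counts_1},\dots,\frac1{n\,Counts_n},0,\dots,0\right)$ and then, for $i=\lceil\log_2 n\rceil-1$ down to $0$, replaces $Votes$ by $add(Votes,rotate(Votes,2^i))$. The key holder receives decided ciphertexts only; it does not send anything. **Learning.** The view of an agent consists of its own initial value (if it has one), its own coins, and all messages it has sent or received. From its view the agent can compute without limits on plaintexts, apply homomorphic operations to ciphertexts it has seen or has encrypted itself, compare ciphertexts for equality, and, if it is the key holder, decrypt; each action may depend on all earlier results. For a fixed delivery schedule, two vectors of initial values are indistinguishable for an agent if every such strategy gives the same output on its two views. An agent learns the initial value of $p_j$ in an execution with initial values $v$ if $v'_j=v_j$ for every $v'\in\mathbb R^n$ that it cannot distinguish from $v$. **Theorem 3.** Suppose that all agents are honest but curious, i.e. they follow Algorithm 1 and do not collude. Then for every $n$, every graph $G$, all initial values $v\in\mathbb R^n$, and every finite delivery schedule (every moment of every asynchronous execution), no agent, i.e. neither the key holder nor any process, learns the initial value of any other process. Moreover, no value can even be excluded: for every agent $a$, every process $p_j\ne a$ and every $w\in\mathbb R$ there is $v'\in\mathbb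 R^n$ with $v'_j=w$ that $a$ cannot distinguish from $v$. -/

import Mathlib

noncomputable section

open scoped Classical

namespace AvgConsensus

/-- The agents: the trusted third party, which alone holds the secret key and has no initial
value, and the `n` processes that run the algorithm. -/
inductive Agent (n : ℕ) : Type
  | keyholder : Agent n
  | proc (i : Fin n) : Agent n

/-- Number of slots of an encrypted vector: `n` rounded up to a power of two (equal to `n` if `n`
is a power of two); the slots beyond the first `n` are padding. -/
abbrev slots (n : ℕ) : ℕ := 2 ^ Nat.clog 2 n

/-- Plaintexts: real vectors. -/
abbrev Vec (n : ℕ) : Type := Fin (slots n) → ℝ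

/-- The slot of process `i`. -/
def slot {n : ℕ} (i : Fin n) : Fin (slots n) :=
  Fin.castLE (Nat.le_pow_clog Nat.one_lt_two n) i

/-- Cyclic rotation of a vector to the left by `t` positions. -/
def rotateVec {n : ℕ} (x : Vec n) (t : ℕ) : Vec n :=
  fun s => x ⟨(s.val + t) % slots n, Nat.mod_lt _ (Nat.pow_pos Nat.two_pos)⟩

/-! ### Homomorphic encryption -/

/-- Expressions built with the public homomorphic operations from leaves in `L`: addition and
multiplication of two ciphertexts (including relinearization), addition and multiplication of a
ciphertext and a plaintext vector, and rotation. -/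
inductive HExpr (n : ℕ) (L : Type) : Type
  | leaf (l : L) : HExpr n L
  | add (c d : HExpr n L) : HExpr n L
  | addPlain (c : HExpr n L) (y : Vec n) : HExpr n L
  | mult (c d : HExpr n L) : HExpr n L
  | multPlain (c : HExpr n L) (y : Vec n) : HExpr n L
  | rotate (c : HExpr n L) (t : ℕ) : HExpr n L

/-- Replacing the leaves of an expression by expressions. -/
def HExpr.subst {n : ℕ} {L L' : Type} (f : L → HExpr n L') : HExpr n L → HExpr n L'
  | .leaf l => f l
  | .add c d => .add (c.subst f) (d.subst f)
  | .addPlain c y => .addPlain (c.subst f) y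
  | .mult c d => .mult (c.subst f) (d.subst f)
  | .multPlain c y => .multPlain (c.subst f) y
  | .rotate c t => .rotate (c.subst f) t

/-- A fresh encryption of `plain` under the public key, with the `coin`-th private random coins of
`owner`. Encryptions of one vector with different coins are different ciphertexts. -/
structure FreshEnc (n : ℕ) : Type where
  plain : Vec n
  owner : Agent n
  coin : ℕ

/-- Ciphertexts of the idealized scheme: formal results of homomorphic operations on fresh
encryptions. They are handled through the operations only: nobody can read the plaintext off a
ciphertext, except by decryption with the secret key. -/
abbrev Ciphertext (n : ℕ) : Type := HExpr n (FreshEnc n)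

/-- Encryption of `x` by agent `a` with its `k`-th coins (the public key is known to all). -/
def encrypt {n : ℕ} (a : Agent n) (k : ℕ) (x : Vec n) : Ciphertext n := .leaf ⟨x, a, k⟩

/-- Decryption. The homomorphic operations act slotwise on the underlying vectors. -/
def decrypt {n : ℕ} : Ciphertext n → Vec n
  | .leaf l => l.plain
  | .add c d => decrypt c + decrypt d
  | .addPlain c y => decrypt c + y
  | .mult c d => decrypt c * decrypt d
  | .multPlain c y => decrypt c * y
  | .rotate c t => rotateVec (decrypt c) t

/-! ### The algorithm -/

/-- Messages: an encrypted vector `Votes` with the plaintext vector `Counts`, or a decided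
(prepared) ciphertext. -/
inductive Msg (n : ℕ) : Type
  | votes (votes : Ciphertext n) (counts : Fin n → ℕ) : Msg n
  | decided (c : Ciphertext n) : Msg n

/-- The ciphertext that a message carries. -/
def Msg.ciphertext {n : ℕ} : Msg n → Ciphertext n
  | .votes c _ => c
  | .decided c => c

/-- The plaintext that a message carries. -/
def Msg.plaintext {n : ℕ} : Msg n → Option (Fin n → ℕ)
  | .votes _ k => some k
  | .decided _ => none

/-- A message in transit. -/
structure Packet (n : ℕ) : Type where
  src : Agent n
  dst : Agent n
  msg : Msg n

/-- Something an agent observes: it sends (`sent = true`) or receives (`sent = false`) a packet.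
Channels are confidential: a packet is observed by its two ends only. -/
structure Obs (n : ℕ) : Type where
  sent : Bool
  packet : Packet n

/-- A global state: the variables `Votes` and `Counts` of each process, the packets in transit,
and what each agent has observed so far, in order. -/
structure Config (n : ℕ) : Type where
  votes : Fin n → Ciphertext n
  counts : Fin n → Fin n → ℕ
  transit : List (Packet n)
  log : Agent n → List (Obs n)

/-- Adding an observation to what agent `a` has observed. -/
def Config.observe {n : ℕ} (C : Config n) (a : Agent n) (o : Obs n) : Config n :=
  { C with log := fun b => if b = a then C.log b ++ [o] else C.log b }

/-- Sending a packet. -/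
def Config.send {n : ℕ} (C : Config n) (p : Packet n) : Config n :=
  { C with transit := C.transit ++ [p] }.observe p.src ⟨true, p⟩

/-- Process `i` sends the message `m` to all its neighbors in the communication graph. -/
def Config.broadcast {n : ℕ} (G : SimpleGraph (Fin n)) (C : Config n) (i : Fin n) (m : Msg n) :
    Config n :=
  ((List.finRange n).filter (fun j => G.Adj i j)).foldl
    (fun D j => D.send ⟨.proc i, .proc j, m⟩) C

/-- The function `Prepare`: multiply slotwise by `1 / (n * counts)`, then add up all slots, for
`i = log n - 1` down to `0`, by rotating by `2 ^ i` and adding. -/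
def prepare {n : ℕ} (votes : Ciphertext n) (counts : Fin n → ℕ) : Ciphertext n :=
  (List.range (Nat.clog 2 n)).reverse.foldl
    (fun c i => HExpr.add c (HExpr.rotate c (2 ^ i)))
    (HExpr.multPlain votes
      (fun s => if h : s.val < n then (counts ⟨s.val, h⟩ : ℝ)⁻¹ / n else 0))

/-- State before any message is sent: `Votes` of process `i` encrypts the vector with `v i` in the
slot of `i` and zeros elsewhere, and `Counts` is the corresponding unit vector. -/
def start {n : ℕ} (v : Fin n → ℝ) : Config n where
  votes := fun i => encrypt (.proc i) 0 (Pi.single (slot i) (v i))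
  counts := fun i => Pi.single i 1
  transit := []
  log := fun _ => []

/-- State after every process has executed `InitConsensus`. -/
def init {n : ℕ} (G : SimpleGraph (Fin n)) (v : Fin n → ℝ) : Config n :=
  (List.finRange n).foldl
    (fun C i => C.broadcast G i (.votes (C.votes i) (C.counts i))) (start v)

/-- Process `i` decides the ciphertext `c`: it sends `c` to the key holder and to its neighbors. -/
def Config.decide {n : ℕ} (G : SimpleGraph (Fin n)) (C : Config n) (i : Fin n)
    (c : Ciphertext n) : Config n :=
  (C.send ⟨.proc i, .keyholder, .decided c⟩).broadcast G i (.decided c)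

/-- The function `Receive` of process `i` for a message with `Votes = c` and `Counts = k`. A message
that brings no new index is ignored. Otherwise it is added to the local variables, these are sent
to the neighbors, and if no entry of `Counts` is zero any more, then process `i` decides. -/
def Config.receive {n : ℕ} (G : SimpleGraph (Fin n)) (C : Config n) (i : Fin n)
    (c : Ciphertext n) (k : Fin n → ℕ) : Config n :=
  if ∀ j, k j ≠ 0 → C.counts i j ≠ 0 then C
  else
    let votes' : Ciphertext n := .add (C.votes i) c
    let counts' : Fin n → ℕ := C.counts i + k
    let D : Config n :=
      { C with
        votes := Function.update C.votes i votes'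
        counts := Function.update C.counts i counts' }.broadcast G i (.votes votes' counts')
    if ∀ j, counts' j ≠ 0 then D.decide G i (prepare votes' counts') else D

/-- Delivery of a packet: its receiver observes it and, if it is a process that obtains a
`(Votes, Counts)` message, executes `Receive`. Decided ciphertexts are only observed. -/
def Config.deliver {n : ℕ} (G : SimpleGraph (Fin n)) (C : Config n) (p : Packet n) : Config n :=
  match p.dst, p.msg with
  | .proc i, .votes c k => (C.observe p.dst ⟨false, p⟩).receive G i c k
  | _, _ => C.observe p.dst ⟨false, p⟩

/-- One asynchronous step: the `t`-th packet in transit is taken and delivered (nothing happens if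
there is no such packet). -/
def Config.step {n : ℕ} (G : SimpleGraph (Fin n)) (C : Config n) (t : ℕ) : Config n :=
  match C.transit[t]? with
  | none => C
  | some p => { C with transit := C.transit.eraseIdx t }.deliver G p

/-- The state reached from the initial values `v` when packets are delivered in the order
prescribed by the schedule. -/
def exec {n : ℕ} (G : SimpleGraph (Fin n)) (v : Fin n → ℝ) (schedule : List ℕ) : Config n :=
  schedule.foldl (fun C t => C.step G t) (init G v)

/-! ### Honest-but-curious agents -/

/-- The initial value of an agent, if it has one. -/
def Agent.input {n : ℕ} (v : Fin n → ℝ) : Agent n → Option ℝ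
  | .keyholder => none
  | .proc i => some (v i)

/-- The part of an agent's view that is in plaintext: its own initial value, and for every packet
sent or received the direction, the two ends, and the plaintext contents. -/
structure PlainView (n : ℕ) : Type where
  input : Option ℝ
  trace : List (Bool × Agent n × Agent n × Option (Fin n → ℕ))

/-- The view of an agent: the plaintext part and the list of ciphertexts sent or received. -/
structure View (n : ℕ) : Type where
  plain : PlainView n
  ciphertexts : List (Ciphertext n)

/-- The view of agent `a` after the execution with initial values `v` and the given schedule. -/
def view {n : ℕ} (G : SimpleGraph (Fin n)) (schedule : List ℕ) (v : Fin n → ℝ) (a : Agent n) :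
    View n where
  plain :=
    { input := a.input v
      trace := ((exec G v schedule).log a).map
        (fun o => (o.sent, o.packet.src, o.packet.dst, o.packet.msg.plaintext)) }
  ciphertexts := ((exec G v schedule).log a).map (fun o => o.packet.msg.ciphertext)

/-- The ciphertexts from which a curious agent can start computing: those it has observed, and
encryptions with its own coins (fresh ones, or the ones it used in the algorithm). -/
inductive Source (n : ℕ) : Type
  | observed (k : ℕ) : Source n
  | own (x : Vec n) (coin : ℕ) : Source n

/-- The ciphertext that agent `a` obtains by applying homomorphic operations to sources. (An index
without observed ciphertext stands for an encryption of zero by `a` itself.) -/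
def evalRecipe {n : ℕ} (a : Agent n) (cs : List (Ciphertext n)) (r : HExpr n (Source n)) :
    Ciphertext n :=
  r.subst fun
    | .observed k => cs.getD k (encrypt a 0 0)
    | .own x k => encrypt a k x

/-- What a curious agent does with its view. It can compute ciphertexts by homomorphic operations,
compare ciphertexts, ask for decryptions, and finally announce a number; each action may depend in
an arbitrary way on all earlier results. -/
inductive Attack (n : ℕ) : Type
  | announce (x : ℝ) : Attack n
  | compare (r s : HExpr n (Source n)) (next : Bool → Attack n) : Attack n
  | decrypt (r : HExpr n (Source n)) (next : Option (Vec n) → Attack n) : Attack n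

/-- The number announced by agent `a`. Only the key holder obtains decryptions. -/
def Attack.run {n : ℕ} (a : Agent n) (cs : List (Ciphertext n)) : Attack n → ℝ
  | .announce x => x
  | .compare r s next =>
      (next (Decidable.decide (evalRecipe a cs r = evalRecipe a cs s))).run a cs
  | .decrypt r next =>
      (next (if a = .keyholder then some (AvgConsensus.decrypt (evalRecipe a cs r)) else none)).run
        a cs

/-- The initial values `v` and `v'` are indistinguishable for agent `a` (under the given schedule):
every strategy, i.e. every attack chosen depending on the plaintext part of the view, has the same
result for both. -/
def Indistinguishable {n : ℕ} (G : SimpleGraph (Fin n)) (schedule : List ℕ) (a : Agent n)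
    (v v' : Fin n → ℝ) : Prop :=
  ∀ S : PlainView n → Attack n,
    (S (view G schedule v a).plain).run a (view G schedule v a).ciphertexts =
      (S (view G schedule v' a).plain).run a (view G schedule v' a).ciphertexts

/-- Agent `a` learns the initial value of process `j` if all initial values that `a` cannot
distinguish from the actual ones `v` have the same `j`-th entry. -/
def Learns {n : ℕ} (G : SimpleGraph (Fin n)) (schedule : List ℕ) (v : Fin n → ℝ) (a : Agent n)
    (j : Fin n) : Prop :=
  ∀ v' : Fin n → ℝ, Indistinguishable G schedule a v v' → v' j = v j

end AvgConsensus

end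

/-!
The proof compares two executions under the same schedule. Changing the initial values from `v` to
`v'` amounts to translating the plaintext of every fresh encryption owned by process `i` by
`v' i - v i` in the slot of `i` (`reinput`). The control flow of the algorithm depends only on the
plaintext counts, so the execution from `v'` is the execution from `v` with all leaves of all
ciphertexts translated (`exec_map`). The translation is injective, and it fixes the leaves owned
by `a` as soon as `v'` agrees with `v` on the input of `a`. Hence it commutes with every computation
of `a` on ciphertexts and preserves the result of every comparison
(`indistinguishable_of_decrypt_eq`).

A process cannot decrypt, so for a process `a` one may change any value other than its own.
The key holder can decrypt, but every ciphertext that reaches it decrypts to the constant vector of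
the average of the initial values (`Invariant`, `decrypt_prepare`), so it cannot tell apart any two
vectors with the same sum; a change of one value is compensated by another process. If there is only
one process, nothing is ever sent.
-/

namespace AvgConsensus

variable {n : ℕ}

/-! ### Relabelling the leaves of ciphertexts -/

/-- Apply `φ` to the leaves of an expression. -/
def HExpr.map {L L' : Type} (φ : L → L') (c : HExpr n L) : HExpr n L' :=
  c.subst fun l => .leaf (φ l)

theorem HExpr.map_injective {L L' : Type} {φ : L → L'} (hφ : Function.Injective φ) :
    Function.Injective (HExpr.map (n := n) φ) := by
  intro c
  induction c with
  | leaf l =>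
    intro d h
    cases d <;> simp only [HExpr.map, HExpr.subst, HExpr.leaf.injEq, reduceCtorEq] at h
    rw [hφ h]
  | add c₁ c₂ h₁ h₂ =>
    intro d h
    cases d <;> simp only [HExpr.map, HExpr.subst, HExpr.add.injEq, reduceCtorEq] at h
    rw [h₁ h.1, h₂ h.2]
  | addPlain c y hc =>
    intro d h
    cases d <;> simp only [HExpr.map, HExpr.subst, HExpr.addPlain.injEq, reduceCtorEq] at h
    rw [hc h.1, h.2]
  | mult c₁ c₂ h₁ h₂ =>
    intro d h
    cases d <;> simp only [HExpr.map, HExpr.subst, HExpr.mult.injEq, reduceCtorEq] at h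
    rw [h₁ h.1, h₂ h.2]
  | multPlain c y hc =>
    intro d h
    cases d <;> simp only [HExpr.map, HExpr.subst, HExpr.multPlain.injEq, reduceCtorEq] at h
    rw [hc h.1, h.2]
  | rotate c t hc =>
    intro d h
    cases d <;> simp only [HExpr.map, HExpr.subst, HExpr.rotate.injEq, reduceCtorEq] at h
    rw [hc h.1, h.2]

theorem HExpr.map_subst {L L' L'' : Type} (φ : L' → L'') (f : L → HExpr n L') (r : HExpr n L) :
    (r.subst f).map φ = r.subst fun l => (f l).map φ := by
  unfold HExpr.map
  induction r <;> simp_all [HExpr.subst]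

/-- Apply `φ` to the leaves of the ciphertext in a message. -/
def Msg.map (φ : FreshEnc n → FreshEnc n) : Msg n → Msg n
  | .votes c k => .votes (c.map φ) k
  | .decided c => .decided (c.map φ)

/-- Apply `φ` to the leaves of the ciphertext in a packet. -/
def Packet.map (φ : FreshEnc n → FreshEnc n) (p : Packet n) : Packet n :=
  { p with msg := p.msg.map φ }

/-- Apply `φ` to the leaves of the ciphertext in an observed packet. -/
def Obs.map (φ : FreshEnc n → FreshEnc n) (o : Obs n) : Obs n :=
  { o with packet := o.packet.map φ }

/-- Apply `φ` to the leaves of all ciphertexts in a global state. -/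
def Config.map (φ : FreshEnc n → FreshEnc n) (C : Config n) : Config n where
  votes := fun i => (C.votes i).map φ
  counts := C.counts
  transit := C.transit.map (Packet.map φ)
  log := fun a => (C.log a).map (Obs.map φ)

theorem Msg.ciphertext_map (φ : FreshEnc n → FreshEnc n) (m : Msg n) :
    (m.map φ).ciphertext = m.ciphertext.map φ := by
  cases m <;> rfl

theorem Msg.plaintext_map (φ : FreshEnc n → FreshEnc n) (m : Msg n) :
    (m.map φ).plaintext = m.plaintext := by
  cases m <;> rfl

/-! ### The algorithm commutes with relabelling -/

section Commute

variable (φ : FreshEnc n → FreshEnc n) (G : SimpleGraph (Fin n))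

theorem Config.map_observe (C : Config n) (a : Agent n) (o : Obs n) :
    (C.observe a o).map φ = (C.map φ).observe a (o.map φ) := by
  simp only [Config.map, Config.observe, Config.mk.injEq, true_and]
  funext b
  split_ifs <;> simp

theorem Config.map_send (C : Config n) (p : Packet n) :
    (C.send p).map φ = (C.map φ).send (p.map φ) := by
  simp only [Config.send, Config.map_observe]
  simp [Config.map, Obs.map, Packet.map]

theorem Config.map_broadcast (C : Config n) (i : Fin n) (m : Msg n) :
    (C.broadcast G i m).map φ = (C.map φ).broadcast G i (m.map φ) := by
  unfold Config.broadcast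
  refine (List.foldl_hom (Config.map φ) ?_).symm
  intro D j
  rw [Config.map_send]
  rfl

theorem map_prepare (c : Ciphertext n) (k : Fin n → ℕ) :
    (prepare c k).map φ = prepare (c.map φ) k := by
  unfold prepare
  exact (List.foldl_hom (HExpr.map φ) fun _ _ => rfl).symm

theorem Config.map_decide (C : Config n) (i : Fin n) (c : Ciphertext n) :
    (C.decide G i c).map φ = (C.map φ).decide G i (c.map φ) := by
  simp only [Config.decide, Config.map_broadcast, Config.map_send]
  rfl

theorem Config.map_receive (C : Config n) (i : Fin n) (c : Ciphertext n) (k : Fin n → ℕ) :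
    (C.receive G i c k).map φ = (C.map φ).receive G i (c.map φ) k := by
  have hupd : ∀ c' : Ciphertext n,
      (fun l => (Function.update C.votes i c' l).map φ) =
        Function.update (fun l => (C.votes l).map φ) i (c'.map φ) := by
    intro c'
    funext l
    by_cases h : l = i
    · subst h; simp
    · simp [h]
  have hcounts : (C.map φ).counts = C.counts := rfl
  simp only [Config.receive, hcounts]
  split_ifs
  · rfl
  all_goals
    simp only [Config.map_decide, map_prepare, Config.map_broadcast]
    simp only [Config.map, hupd]
    rfl

theorem Config.map_deliver (C : Config n) (p : Packet n) :
    (C.deliver G p).map φ = (C.map φ).deliver G (p.map φ) := by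
  rcases p with ⟨src, dst, m⟩
  cases dst <;> cases m <;>
    simp only [Config.deliver, Packet.map, Msg.map, Config.map_receive, Config.map_observe,
      Obs.map]

theorem Config.map_step (C : Config n) (t : ℕ) :
    (C.step G t).map φ = (C.map φ).step G t := by
  have htransit : (C.map φ).transit = C.transit.map (Packet.map φ) := rfl
  simp only [Config.step, htransit, List.getElem?_map]
  cases C.transit[t]? with
  | none => rfl
  | some p =>
    simp only [Option.map_some, Config.map_deliver]
    simp [Config.map, List.eraseIdx_map]

theorem exec_map {v v' : Fin n → ℝ} (hstart : (start v).map φ = start v') (schedule : List ℕ) :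
    exec G v' schedule = (exec G v schedule).map φ := by
  have hinit : init G v' = (init G v).map φ := by
    unfold init
    rw [← hstart]
    refine List.foldl_hom (Config.map φ) ?_
    intro C i
    rw [Config.map_broadcast]
    rfl
  unfold exec
  rw [hinit]
  exact List.foldl_hom (Config.map φ) fun C t => (Config.map_step φ G C t).symm

end Commute

/-! ### Indistinguishability -/

/-- The change of the plaintexts of an agent when the initial values change from `v` to `v'`. -/
noncomputable def inputShift (v v' : Fin n → ℝ) : Agent n → Vec n
  | .keyholder => 0
  | .proc i => Pi.single (slot i) (v' i - v i)

/-- The relabelling that turns the initial ciphertexts for `v` into those for `v'`. All fresh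
encryptions of an agent are translated alike, also those that the algorithm does not use: this
makes the relabelling injective. -/
noncomputable def reinput (v v' : Fin n → ℝ) (l : FreshEnc n) : FreshEnc n :=
  { l with plain := l.plain + inputShift v v' l.owner }

theorem reinput_injective (v v' : Fin n → ℝ) : Function.Injective (reinput v v') := by
  rintro ⟨x, a, k⟩ ⟨y, b, l⟩ h
  simp only [reinput, FreshEnc.mk.injEq] at h
  obtain ⟨h, rfl, rfl⟩ := h
  rw [add_right_cancel h]

theorem start_map_reinput (v v' : Fin n → ℝ) : (start v).map (reinput v v') = start v' := by
  simp only [Config.map, start, List.map_nil, Config.mk.injEq, and_true]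
  funext i
  simp [encrypt, HExpr.map, HExpr.subst, reinput, inputShift, ← Pi.single_add]

theorem inputShift_eq_zero {v v' : Fin n → ℝ} {a : Agent n} (h : a.input v' = a.input v) :
    inputShift v v' a = 0 := by
  cases a with
  | keyholder => rfl
  | proc i =>
    have h' : v' i = v i := Option.some.inj h
    simp [inputShift, h']

theorem evalRecipe_map {φ : FreshEnc n → FreshEnc n} {a : Agent n}
    (hφ : ∀ x k, φ ⟨x, a, k⟩ = ⟨x, a, k⟩) (cs : List (Ciphertext n)) (r : HExpr n (Source n)) :
    evalRecipe a (cs.map (HExpr.map φ)) r = (evalRecipe a cs r).map φ := by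
  have hown : ∀ x k, (encrypt a k x).map φ = encrypt a k x := fun x k => by
    simp [encrypt, HExpr.map, HExpr.subst, hφ]
  unfold evalRecipe
  rw [HExpr.map_subst]
  congr 1
  funext s
  cases s with
  | observed k =>
    simp only [List.getD_eq_getElem?_getD, List.getElem?_map]
    cases cs[k]? <;> simp [hown]
  | own x k => exact (hown x k).symm

/-- If no comparison and no decryption distinguishes two lists of ciphertexts, then no adaptive
attack does. -/
theorem Attack.run_congr {a : Agent n} {cs cs' : List (Ciphertext n)}
    (hcmp : ∀ r s, evalRecipe a cs r = evalRecipe a cs s ↔ evalRecipe a cs' r = evalRecipe a cs' s)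
    (hdec : a = .keyholder →
      ∀ r, AvgConsensus.decrypt (evalRecipe a cs r) = AvgConsensus.decrypt (evalRecipe a cs' r))
    (A : Attack n) : A.run a cs = A.run a cs' := by
  induction A with
  | announce x => rfl
  | compare r s next ih =>
    simp only [Attack.run, ih]
    rw [decide_eq_decide.mpr (hcmp r s)]
  | decrypt r next ih =>
    simp only [Attack.run, ih]
    split_ifs with h
    · rw [hdec h r]
    · rfl

/-- Only decryption can distinguish two vectors of initial values that agree on the agent's own
input. -/
theorem indistinguishable_of_decrypt_eq (G : SimpleGraph (Fin n)) (schedule : List ℕ)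
    {a : Agent n} {v v' : Fin n → ℝ} (hinput : a.input v' = a.input v)
    (hdec : a = .keyholder → ∀ r,
      decrypt (evalRecipe a (view G schedule v a).ciphertexts r) =
        decrypt (evalRecipe a (view G schedule v' a).ciphertexts r)) :
    Indistinguishable G schedule a v v' := by
  have hexec := exec_map (reinput v v') G (start_map_reinput v v') schedule
  have hcs : (view G schedule v' a).ciphertexts =
      (view G schedule v a).ciphertexts.map (HExpr.map (reinput v v')) := by
    simp [view, hexec, Config.map, Obs.map, Packet.map, Msg.ciphertext_map, Function.comp_def]
  have hplain : (view G schedule v' a).plain = (view G schedule v a).plain := by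
    simp [view, hexec, Config.map, Obs.map, Packet.map, Msg.plaintext_map, Function.comp_def,
      hinput]
  have hfix : ∀ x k, reinput v v' ⟨x, a, k⟩ = ⟨x, a, k⟩ := fun x k => by
    simp [reinput, inputShift_eq_zero hinput]
  intro S
  rw [hplain]
  refine Attack.run_congr (fun r s => ?_) hdec _
  rw [hcs, evalRecipe_map hfix, evalRecipe_map hfix]
  exact (HExpr.map_injective (reinput_injective v v')).eq_iff.symm

/-- An agent that sees only ciphertexts of one and the same vector `x` can predict the decryption of
each ciphertext that it computes. -/
theorem decrypt_evalRecipe_congr {a : Agent n} {cs cs' : List (Ciphertext n)} {x : Vec n}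
    (hlen : cs.length = cs'.length) (h : ∀ c ∈ cs, decrypt c = x) (h' : ∀ c ∈ cs', decrypt c = x)
    (r : HExpr n (Source n)) :
    decrypt (evalRecipe a cs r) = decrypt (evalRecipe a cs' r) := by
  unfold evalRecipe
  induction r with
  | leaf s =>
    cases s with
    | observed k =>
      simp only [HExpr.subst]
      by_cases hk : k < cs.length
      · rw [List.getD_eq_getElem _ _ hk, List.getD_eq_getElem _ _ (hlen ▸ hk),
          h _ (List.getElem_mem _), h' _ (List.getElem_mem _)]
      · rw [List.getD_eq_default _ _ (not_lt.mp hk),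
          List.getD_eq_default _ _ (hlen ▸ not_lt.mp hk)]
    | own x k => rfl
  | _ => simp_all [HExpr.subst, decrypt]

/-! ### What the key holder can decrypt -/

/-- Rotating and adding for `i = m - 1, …, 0` puts into each slot the sum of the `2 ^ m` cyclically
consecutive slots that start there. -/
theorem decrypt_foldl_rotate (m : ℕ) (c : Ciphertext n) (s : Fin (slots n)) :
    decrypt ((List.range m).reverse.foldl
      (fun c i => HExpr.add c (HExpr.rotate c (2 ^ i))) c) s =
      ∑ t ∈ Finset.range (2 ^ m), rotateVec (decrypt c) t s := by
  induction m generalizing c with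
  | zero => simp [rotateVec, Nat.mod_eq_of_lt s.isLt]
  | succ m ih =>
    rw [List.range_succ, List.reverse_append, List.reverse_singleton, List.singleton_append,
      List.foldl_cons, ih, pow_succ, mul_two, Finset.sum_range_add, ← Finset.sum_add_distrib]
    refine Finset.sum_congr rfl fun t _ => ?_
    simp only [decrypt, rotateVec, Pi.add_apply, Nat.mod_add_mod]
    congr 4
    ring

theorem sum_rotateVec (x : Vec n) (s : Fin (slots n)) :
    ∑ t ∈ Finset.range (slots n), rotateVec x t s = ∑ u, x u := by
  rw [← Fin.sum_univ_eq_sum_range (fun t => rotateVec x t s)]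
  exact Equiv.sum_comp (Equiv.addLeft s) x

/-- The vector whose slot for process `i` is `f i`, with zeros in the padding slots. -/
noncomputable def padded (f : Fin n → ℝ) : Vec n :=
  fun s => if h : s.val < n then f ⟨s.val, h⟩ else 0

theorem sum_padded (f : Fin n → ℝ) : ∑ s, padded f s = ∑ i, f i := by
  have hle : n ≤ slots n := Nat.le_pow_clog Nat.one_lt_two n
  let g : ℕ → ℝ := fun s => if h : s < n then f ⟨s, h⟩ else 0
  calc ∑ s, padded f s = ∑ s ∈ Finset.range (slots n), g s := Fin.sum_univ_eq_sum_range g _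
    _ = ∑ s ∈ Finset.range n, g s := by
      refine (Finset.sum_subset (Finset.range_subset_range.mpr hle) fun s _ hs => ?_).symm
      exact dif_neg (by simpa using hs)
    _ = ∑ i, f i := by
      rw [← Fin.sum_univ_eq_sum_range]
      exact Finset.sum_congr rfl fun i _ => dif_pos i.isLt

/-- The constant vector of the average of `v`. -/
noncomputable def avgVec (v : Fin n → ℝ) : Vec n := fun _ => (∑ i, v i) / n

theorem decrypt_prepare {v : Fin n → ℝ} {c : Ciphertext n} {k : Fin n → ℕ}
    (hc : decrypt c = padded fun i => k i * v i) (hk : ∀ i, k i ≠ 0) :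
    decrypt (prepare c k) = avgVec v := by
  have hmul : decrypt c * (fun s : Fin (slots n) =>
      if h : s.val < n then (k ⟨s.val, h⟩ : ℝ)⁻¹ / n else 0) = padded fun i => v i / n := by
    rw [hc]
    funext s
    simp only [padded, Pi.mul_apply]
    split_ifs with h
    · have := hk ⟨s.val, h⟩
      field_simp
    · simp
  funext s
  rw [prepare, decrypt_foldl_rotate, sum_rotateVec, decrypt, hmul, sum_padded, avgVec,
    Finset.sum_div]

/-- The meaning of a message: the votes are the multiples of `v` given by the counts, and a decided
ciphertext contains the average. -/
def Msg.Correct (v : Fin n → ℝ) : Msg n → Prop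
  | .votes c k => decrypt c = padded fun i => k i * v i
  | .decided c => decrypt c = avgVec v

/-- Packets are correct, never come from the key holder, and bring it decided ciphertexts only. -/
structure Packet.Correct (v : Fin n → ℝ) (p : Packet n) : Prop where
  msg : p.msg.Correct v
  src : p.src ≠ .keyholder
  dst : p.dst = .keyholder → decrypt p.msg.ciphertext = avgVec v

/-- An invariant of the executions from `v`, by which the key holder observes only encryptions of
the average. -/
structure Invariant (v : Fin n → ℝ) (C : Config n) : Prop where
  votes : ∀ i, decrypt (C.votes i) = padded fun j => C.counts i j * v j
  transit : ∀ p ∈ C.transit, p.Correct v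
  log : ∀ o ∈ C.log .keyholder, decrypt o.packet.msg.ciphertext = avgVec v

section Invariance

variable {v : Fin n → ℝ} {C : Config n} (G : SimpleGraph (Fin n))

theorem Invariant.observe (h : Invariant v C) {a : Agent n} {o : Obs n}
    (ho : a = .keyholder → decrypt o.packet.msg.ciphertext = avgVec v) :
    Invariant v (C.observe a o) := by
  refine ⟨h.votes, h.transit, fun o' ho' => ?_⟩
  simp only [Config.observe] at ho'
  split_ifs at ho' with ha
  · rcases List.mem_append.mp ho' with ho' | ho'
    · exact h.log _ ho'
    · rw [List.mem_singleton.mp ho']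
      exact ho ha.symm
  · exact h.log _ ho'

theorem Invariant.send (h : Invariant v C) {p : Packet n} (hp : p.Correct v) :
    Invariant v (C.send p) := by
  have h' : Invariant v { C with transit := C.transit ++ [p] } := by
    refine ⟨h.votes, fun q hq => ?_, h.log⟩
    rcases List.mem_append.mp hq with hq | hq
    · exact h.transit _ hq
    · rw [List.mem_singleton.mp hq]
      exact hp
  exact h'.observe fun hsrc => absurd hsrc hp.src

theorem Invariant.broadcast (h : Invariant v C) (i : Fin n) {m : Msg n} (hm : m.Correct v) :
    Invariant v (C.broadcast G i m) := by
  unfold Config.broadcast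
  refine List.foldlRecOn _ _ h fun D hD j _ => hD.send ⟨hm, ?_, ?_⟩ <;> simp

theorem Invariant.decide (h : Invariant v C) (i : Fin n) {c : Ciphertext n}
    (hc : AvgConsensus.decrypt c = avgVec v) : Invariant v (C.decide G i c) := by
  have hp : Packet.Correct v ⟨.proc i, .keyholder, .decided c⟩ := ⟨hc, by simp, fun _ => hc⟩
  exact (h.send hp).broadcast G i hc

theorem Invariant.receive (h : Invariant v C) (i : Fin n) {c : Ciphertext n} {k : Fin n → ℕ}
    (hc : (Msg.votes c k).Correct v) : Invariant v (C.receive G i c k) := by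
  have hsum : (Msg.votes (.add (C.votes i) c) (C.counts i + k)).Correct v := by
    simp only [Msg.Correct] at hc
    simp only [Msg.Correct, decrypt, h.votes, hc]
    funext s
    simp only [padded, Pi.add_apply, Nat.cast_add, add_mul]
    split_ifs <;> simp
  have hD : Invariant v { C with
      votes := Function.update C.votes i (.add (C.votes i) c)
      counts := Function.update C.counts i (C.counts i + k) } := by
    refine ⟨fun l => ?_, h.transit, h.log⟩
    by_cases hl : l = i
    · subst hl
      simpa [Msg.Correct] using hsum
    · simpa [hl] using h.votes l
  simp only [Config.receive]
  split_ifs with h₁ h₂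
  · exact h
  · exact (hD.broadcast G i hsum).decide G i (decrypt_prepare hsum h₂)
  · exact hD.broadcast G i hsum

theorem Invariant.deliver (h : Invariant v C) {p : Packet n} (hp : p.Correct v) :
    Invariant v (C.deliver G p) := by
  have hobs : Invariant v (C.observe p.dst ⟨false, p⟩) := h.observe hp.dst
  unfold Config.deliver
  split
  · next hm => exact hobs.receive G _ (hm ▸ hp.msg)
  · exact hobs

theorem Invariant.step (h : Invariant v C) (t : ℕ) : Invariant v (C.step G t) := by
  unfold Config.step
  split
  · exact h
  · next p ht =>
    have h' : Invariant v { C with transit := C.transit.eraseIdx t } :=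
      ⟨h.votes, fun q hq => h.transit q (List.mem_of_mem_eraseIdx hq), h.log⟩
    exact h'.deliver G (h.transit p (List.mem_of_getElem? ht))

theorem invariant_start (v : Fin n → ℝ) : Invariant v (start v) := by
  refine ⟨fun i => ?_, by simp [start], by simp [start]⟩
  funext s
  simp only [start, encrypt, decrypt, padded, Pi.single_apply, slot, Fin.ext_iff, Fin.val_castLE]
  split_ifs with h₁ h₂
  · simp [h₁]
  · exact absurd (h₁ ▸ i.isLt) h₂
  · simp
  · rfl

theorem invariant_exec (v : Fin n → ℝ) (schedule : List ℕ) :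
    Invariant v (exec G v schedule) := by
  unfold exec init
  refine List.foldlRecOn _ _ ?_ fun C hC t _ => hC.step G t
  exact List.foldlRecOn _ _ (invariant_start v) fun C hC i _ => hC.broadcast G i (hC.votes i)

end Invariance

/-- With at most one process there are no channels between processes, hence no messages at all. -/
theorem exec_eq_start [Subsingleton (Fin n)] (G : SimpleGraph (Fin n)) (v : Fin n → ℝ)
    (schedule : List ℕ) : exec G v schedule = start v := by
  have hG : ∀ i j, ¬ G.Adj i j := fun i j h => h.ne (Subsingleton.elim i j)
  have hinit : init G v = start v := by
    unfold init
    refine List.foldlRecOn (motive := (· = start v)) _ _ rfl fun C hC i _ => ?_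
    simpa [Config.broadcast, hG] using hC
  unfold exec
  rw [hinit]
  refine List.foldlRecOn (motive := (· = start v)) _ _ rfl fun C hC t _ => ?_
  rw [hC]
  rfl

theorem indistinguishable_keyholder_of_sum_eq (G : SimpleGraph (Fin n)) (schedule : List ℕ)
    {v v' : Fin n → ℝ} (h : ∑ i, v' i = ∑ i, v i) :
    Indistinguishable G schedule .keyholder v v' := by
  refine indistinguishable_of_decrypt_eq G schedule rfl fun _ => ?_
  have havg : avgVec v' = avgVec v := by unfold avgVec; rw [h]
  have hview : ∀ u : Fin n → ℝ, ∀ c ∈ (view G schedule u .keyholder).ciphertexts,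
      decrypt c = avgVec u := by
    intro u c hc
    obtain ⟨o, ho, rfl⟩ := List.mem_map.mp hc
    exact (invariant_exec G u schedule).log o ho
  refine decrypt_evalRecipe_congr ?_ (hview v) (havg ▸ hview v')
  simp [view, exec_map _ G (start_map_reinput v v') schedule, Config.map]

/-- Every agent considers every initial value of another process possible. -/
theorem exists_indistinguishable (G : SimpleGraph (Fin n)) (schedule : List ℕ) (v : Fin n → ℝ)
    {a : Agent n} {j : Fin n} (haj : a ≠ .proc j) (w : ℝ) :
    ∃ v' : Fin n → ℝ, v' j = w ∧ Indistinguishable G schedule a v v' := by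
  cases a with
  | proc i =>
    have hij : i ≠ j := fun h => haj (h ▸ rfl)
    refine ⟨Function.update v j w, by simp, ?_⟩
    exact indistinguishable_of_decrypt_eq G schedule (by simp [Agent.input, hij])
      fun h => nomatch h
  | keyholder =>
    by_cases hj : ∃ k, k ≠ j
    · obtain ⟨k, hk⟩ := hj
      -- Process `k` compensates the change at `j`, so that the sum does not change.
      refine ⟨v + Pi.single j (w - v j) - Pi.single k (w - v j), by simp [hk.symm], ?_⟩
      apply indistinguishable_keyholder_of_sum_eq
      simp [Finset.sum_add_distrib, Finset.sum_sub_distrib]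
    · push Not at hj
      have : Subsingleton (Fin n) := ⟨fun x y => (hj x).trans (hj y).symm⟩
      refine ⟨fun _ => w, rfl, indistinguishable_of_decrypt_eq G schedule rfl fun _ r => ?_⟩
      simp [view, exec_eq_start, start]

end AvgConsensus

theorem theorem3 {n : ℕ} (G : SimpleGraph (Fin n)) (schedule : List ℕ) (v : Fin n → ℝ)
    (a : AvgConsensus.Agent n) (j : Fin n) (haj : a ≠ AvgConsensus.Agent.proc j) :
    ¬ AvgConsensus.Learns G schedule v a j ∧
      ∀ w : ℝ, ∃ v' : Fin n → ℝ,
        v' j = w ∧ AvgConsensus.Indistinguishable G schedule a v v' := by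
  refine ⟨fun hlearn => ?_, AvgConsensus.exists_indistinguishable G schedule v haj⟩
  obtain ⟨v', hw, hv'⟩ := AvgConsensus.exists_indistinguishable G schedule v haj (v j + 1)
  have := hlearn v' hv'
  linarith
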